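/- **Corollary 4.5 (Model consistency of continuous time DGD).** Let $R:\mathbb R^p\to\mathbb R\cup\{+\infty\}$ be proper, convex and lower semicontinuous, let $\alpha>0$ and $R_\alpha=R+\frac{\alpha}{2}\|\cdot\|^2$, let $X\in\mathbb R^{n\times p}$ be nonzero with spectral norm $\|X\|$, and let $y^\dagger\in\mathbb R^n$. For $y\in\mathbb R^n$ put $\phi_y(v)=R_\alpha^*(-X^\top v)+\langle y,v\rangle$, where $R_\alpha^*$ is the Fenchel conjugate of $R_\alpha$, and consider the dual gradient flow $$v(0)=0,\qquad \dot v(t)=-\nabla\phi_y(v(t)),\qquad w(t)=\nabla R_\alpha^*(-X^\top v(t)),\qquad t\ge 0.$$ Denote by $(v_0,w_0)$ its solution for $y=y^\dagger$, and by $(v_\delta,w_\delta)$ its solution for $y=y_\delta$, where $\|y_\delta-y^\dagger\|\le\delta$. Let $\mathcal M_{w^\dagger}\subset\mathbb R^p$ and assume: 1. $w^\dagger$ is the unique minimizer of $R_\alpha(w)$ subject to $Xw=y^\dagger$, and $v_0(t)\to v^\dagger$ as $t\to\infty$, where $v^\dagger$ is a minimizer of $\phi_{y^\dagger}$. 2.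 $z^\dagger:=-X^\top v^\dagger\in\mathrm{ri}(\partial R_\alpha(w^\dagger))$. 3. $R$ is partly smooth at $w^\dagger$ relative to $\mathcal M_{w^\dagger}$: $\partial R(w^\dagger)\neq\emptyset$; $\mathcal M_{w^\dagger}$ is a $C^2$ manifold around $w^\dagger$ and $R|_{\mathcal M_{w^\dagger}}$ is $C^2$ near $w^\dagger$; the tangent space of $\mathcal M_{w^\dagger}$ at $w^\dagger$ is the orthogonal complement of the linear span of $\partial R(w^\dagger)-\partial R(w^\dagger)$; and $\partial R$ is continuous (in the Painlevé–Kuratowski sense) along $\mathcal M_{w^\dagger}$ near $w^\dagger$. 4. $\epsilon>0$, $\mathcal U_\epsilon=\bigcup\{w+\partial R_\alpha(w): w\in\mathcal M_{w^\dagger},\ \|w-w^\dagger\|<\epsilon\}$, $c>0$, and $\kappa<\mathrm{dist}(w^\dagger+z^\dagger,\mathrm{bdy}(\mathcal U_\epsilon))$ (the distance to the empty set being $+\infty$). Then there is $\delta_0>0$ such that for all $\delta\in\,]0,\delta_0[$, all $y_\delta$ with $\|y_\delta-y^\dagger\|\le\delta$, and every stopping time of the form $t_\delta=\gamma\,c_\delta\,\delta^{-1}$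 with $\gamma=\alpha\|X\|^{-2}$, $c_\delta\ge c$ and $\alpha c_\delta\|X\|^{-1}\le\kappa$, one has $$w_\delta(t_\delta)\in\mathcal M_{w^\dagger}.$$ Moreover, there exist $0<\underline t<t_\delta<\overline t$ such that $w_\delta(t)\in\mathcal M_{w^\dagger}$ for all $t\in[\underline t,\overline t]$. -/

import Mathlib

open Filter Topology
open scoped Pointwise

noncomputable section

namespace DualFlow

section Convex

variable {E : Type*} [NormedAddCommGroup E] [InnerProductSpace ℝ E]

/-- The class `Γ₀(E)` of proper, convex, lower semicontinuous functions `E → ℝ ∪ {+∞}`.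
The value `-∞` of `EReal` is excluded, and convexity is convexity of the epigraph. -/
structure IsGammaZero (R : E → EReal) : Prop where
  ne_bot : ∀ w, R w ≠ ⊥
  proper : ∃ w, R w ≠ ⊤
  convex : Convex ℝ {q : E × ℝ | R q.1 ≤ (q.2 : EReal)}
  lsc : LowerSemicontinuous R

/-- The convex subdifferential `∂R(w)`; it is empty outside the domain of `R`. -/
def subdiff (R : E → EReal) (w : E) : Set E :=
  {u | R w ≠ ⊤ ∧ ∀ w', R w + ((inner ℝ u (w' - w) : ℝ) : EReal) ≤ R w'}

/-- The Fenchel conjugate `R^*(u) = sup_w (⟨u, w⟩ - R(w))`. -/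
def conj (R : E → EReal) (u : E) : EReal :=
  ⨆ w, ((inner ℝ u w : ℝ) : EReal) - R w

/-- The strongly convex regularizer `R_α = R + (α / 2) ‖·‖²`. -/
def regularized (R : E → EReal) (α : ℝ) (w : E) : EReal :=
  R w + ((α / 2 * ‖w‖ ^ 2 : ℝ) : EReal)

/-- `w` is the unique minimizer of `f` over the set `C`. -/
def IsUniqueMinimizerOn (f : E → EReal) (C : Set E) (w : E) : Prop :=
  w ∈ C ∧ IsMinOn f C w ∧ ∀ w' ∈ C, IsMinOn f C w' → w' = w

end Convex

section PartialSmoothness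

variable {E : Type*} [NormedAddCommGroup E] [InnerProductSpace ℝ E]

/-- `M` is a `C²` manifold around its point `w`: near `w` it is the zero set of a `C²` map whose
derivative at `w` is onto. -/
def IsC2ManifoldAround (M : Set E) (w : E) : Prop :=
  w ∈ M ∧ ∃ (k : ℕ) (F : E → EuclideanSpace ℝ (Fin k)),
    ContDiffAt ℝ 2 F w ∧ Function.Surjective (fderiv ℝ F w) ∧
      ∀ᶠ x in 𝓝 w, x ∈ M ↔ F x = 0

/-- Tangent vectors to `M` at `w`: velocities at time `0` of curves in `M` through `w`. -/
def tangentVectors (M : Set E) (w : E) : Set E :=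
  {u | ∃ g : ℝ → E, g 0 = w ∧ (∀ᶠ t in 𝓝 0, g t ∈ M) ∧ HasDerivAt g u 0}

/-- The restriction of `R` to `M` is `C²` near `w`: it agrees on `M`, near `w`, with a
real-valued function that is `C²` near `w`. -/
def IsC2AlongNear (R : E → EReal) (M : Set E) (w : E) : Prop :=
  ∃ g : E → ℝ, ContDiffAt ℝ 2 g w ∧ ∀ᶠ x in 𝓝[M] w, R x = (g x : EReal)

/-- Continuity (in the sense of Painlevé and Kuratowski) of a set-valued map `S` at `w` along `M`:
inner semicontinuity and outer semicontinuity. -/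
def SetValuedContinuousWithinAt (S : E → Set E) (M : Set E) (w : E) : Prop :=
  (∀ z ∈ S w, ∀ η > 0, ∀ᶠ x in 𝓝[M] w, (S x ∩ Metric.ball z η).Nonempty) ∧
  (∀ z, (∀ η > 0, ∃ᶠ x in 𝓝[M] w, (S x ∩ Metric.ball z η).Nonempty) → z ∈ S w)

/-- `R ∈ Γ₀` is partly smooth at `w` relative to `M`. The subspace `vectorSpan ℝ S` is the linear
subspace spanned by the differences of elements of `S`, so its orthogonal complement for
`S = ∂R(w)` is the model tangent subspace `T_w`. -/
structure PartlySmoothAt (R : E → EReal) (M : Set E) (w : E) : Prop where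
  gammaZero : IsGammaZero R
  subdiff_nonempty : (subdiff R w).Nonempty
  manifold : IsC2ManifoldAround M w
  smooth : IsC2AlongNear R M w
  sharp : tangentVectors M w = ((vectorSpan ℝ (subdiff R w))ᗮ : Submodule ℝ E)
  continuous : ∀ᶠ x in 𝓝[M] w, SetValuedContinuousWithinAt (subdiff R) M x

/-- The local union `𝓤_ε = ⋃ (w + ∂f(w))` over `w ∈ M` with `‖w - w₀‖ < ε`. -/
def localUnion (f : E → EReal) (M : Set E) (w₀ : E) (ε : ℝ) : Set E :=
  ⋃ w ∈ M ∩ Metric.ball w₀ ε, w +ᵥ subdiff f w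

end PartialSmoothness

section Dual

variable {E F : Type*} [NormedAddCommGroup E] [InnerProductSpace ℝ E] [CompleteSpace E]
  [NormedAddCommGroup F] [InnerProductSpace ℝ F] [CompleteSpace F]

/-- The dual vector `-Xᵀ v`. -/
def dualToPrimal (X : E →L[ℝ] F) (v : F) : E := -(ContinuousLinearMap.adjoint X v)

/-- The dual objective `φ(v) = R_α^*(-Xᵀ v) + ⟨y, v⟩`. -/
def dualObjective (R : E → EReal) (α : ℝ) (X : E →L[ℝ] F) (y v : F) : EReal :=
  conj (regularized R α) (dualToPrimal X v) + ((inner ℝ y v : ℝ) : EReal)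

/-- The gradient `∇R_α^*`. For `R ∈ Γ₀` and `α > 0` the conjugate `R_α^*` is finite and
differentiable everywhere. -/
def gradConj (R : E → EReal) (α : ℝ) (z : E) : E :=
  gradient (fun u => (conj (regularized R α) u).toReal) z

/-- `v` solves the dual gradient flow `v' = -∇φ(v)` on `[0, ∞)` with `v(0) = 0`
(one-sided derivative at time `0`). -/
def IsDualGradientFlow (R : E → EReal) (α : ℝ) (X : E →L[ℝ] F) (y : F) (v : ℝ → F) : Prop :=
  v 0 = 0 ∧ ∀ t, 0 ≤ t →
    HasDerivWithinAt v (-gradient (fun u => (dualObjective R α X y u).toReal) (v t)) (Set.Ici 0) t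

/-- The primal trajectory `w(t) = ∇R_α^*(-Xᵀ v(t))`. -/
def primalTrajectory (R : E → EReal) (α : ℝ) (X : E →L[ℝ] F) (v : ℝ → F) (t : ℝ) : E :=
  gradConj R α (dualToPrimal X (v t))

end Dual

end DualFlow

end

/-! Strong convexity makes `∂R_α` strongly monotone and onto, so its inverse `∇R_α^*` is
single-valued and Lipschitz, and the sum `w + z` with `z ∈ ∂R_α(w)` determines `w`
(`eq_of_add_eq_add`). Hence `w(t)` lies on `M` as soon as `w(t) + z(t)`, where `z(t) = -Xᵀ v(t)`,
lies in the local union. That union contains `w₀ + z₀`, where `z₀ = -Xᵀ v₀`, and therefore a ball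
around it of some radius exceeding `κ` (`ball_subset_of_lt_infEDist_frontier`).

It remains to bound two errors at the stopping time. The dual one is at most `‖X‖ δ t ≤ κ`
(`norm_sub_le`) plus the error of the noise-free flow, small because `t` is of order at least `δ⁻¹`.
The primal one must tend to zero although `δ t` does not (`exists_norm_primalTrajectory_sub_le`):
the residual is nonincreasing, so a large error at time `t` persists on all of `[0, t]` and would
drive `‖v - v₀‖²` below zero. Continuity extends the conclusion to an interval. -/

namespace DualFlow

/-! ### Strong convexity of `R_α` and smoothness of its conjugate. -/

section RegularizedConjugate

variable {E : Type*} [NormedAddCommGroup E] {R : E → EReal} {α : ℝ}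

lemma regularized_eq_coe {w : E} {a : ℝ} (ha : R w = a) :
    regularized R α w = ((a + α / 2 * ‖w‖ ^ 2 : ℝ) : EReal) := by
  simp [regularized, ha]

lemma regularized_eq_top {w : E} (hw : R w = ⊤) : regularized R α w = ⊤ := by
  rw [regularized, hw, EReal.top_add_coe]

variable [InnerProductSpace ℝ E]

lemma IsGammaZero.eq_top_or_eq_coe (hR : IsGammaZero R) (w : E) :
    R w = ⊤ ∨ ∃ a : ℝ, R w = a := by
  have h := hR.ne_bot w
  induction hw : R w with
  | bot => exact absurd hw h
  | top => exact Or.inl rfl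
  | coe a => exact Or.inr ⟨a, rfl⟩

/-- Membership in the subdifferential of the regularized function, in terms of real values. -/
lemma mem_subdiff_regularized_iff (hR : IsGammaZero R) {w z : E} {a : ℝ} (ha : R w = a) :
    z ∈ subdiff (regularized R α) w ↔ ∀ w' (b : ℝ), R w' = b →
      a + α / 2 * ‖w‖ ^ 2 + inner ℝ z (w' - w) ≤ b + α / 2 * ‖w'‖ ^ 2 := by
  simp only [subdiff, Set.mem_ofPred_eq, regularized_eq_coe ha]
  constructor
  · rintro ⟨-, h⟩ w' b hb
    have := h w'
    rw [regularized_eq_coe hb] at this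
    exact_mod_cast this
  · intro h
    refine ⟨EReal.coe_ne_top _, fun w' => ?_⟩
    rcases hR.eq_top_or_eq_coe w' with hw' | ⟨b, hb⟩
    · rw [regularized_eq_top hw']; exact le_top
    · rw [regularized_eq_coe hb]
      exact_mod_cast h w' b hb

lemma IsGammaZero.exists_eq_coe_of_mem_subdiff (hR : IsGammaZero R) {w z : E}
    (hz : z ∈ subdiff (regularized R α) w) : ∃ a : ℝ, R w = a := by
  rcases hR.eq_top_or_eq_coe w with h | h
  · exact absurd (regularized_eq_top h) hz.1
  · exact h

/-- The subgradient inequality of the `α`-strongly convex function `R_α`. -/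
lemma strong_subgradient_inequality (hR : IsGammaZero R) {w z : E} {a : ℝ} (ha : R w = a)
    (hz : z ∈ subdiff (regularized R α) w) {w' : E} {b : ℝ} (hb : R w' = b) :
    a + α / 2 * ‖w‖ ^ 2 + inner ℝ z (w' - w) + α / 2 * ‖w' - w‖ ^ 2 ≤
      b + α / 2 * ‖w'‖ ^ 2 := by
  rw [mem_subdiff_regularized_iff hR ha] at hz
  set d := w' - w with hd
  have hw' : w' = w + d := by simp [hd]
  -- Test the subgradient inequality at `w + t d`, bound `R` there by convexity, expand the square
  -- exactly and divide by `t`; the error vanishes as `t → 0`.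
  have key : ∀ t : ℝ, 0 < t → t < 1 →
      a + α / 2 * ‖w‖ ^ 2 + inner ℝ z d + α / 2 * ‖d‖ ^ 2 - (b + α / 2 * ‖w'‖ ^ 2) ≤
        t * (α / 2 * ‖d‖ ^ 2) := by
    intro t ht0 ht1
    have hconv := hR.convex (x := (w, a)) (by simp [ha]) (y := (w', b)) (by simp [hb])
      (a := 1 - t) (b := t) (by linarith) ht0.le (by ring)
    simp only [Set.mem_ofPred_eq, Prod.smul_mk, Prod.mk_add_mk, smul_eq_mul] at hconv
    have hpt : (1 - t) • w + t • w' = w + t • d := by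
      rw [hw']; module
    rw [hpt] at hconv
    rcases hR.eq_top_or_eq_coe (w + t • d) with htop | ⟨e, he⟩
    · rw [htop] at hconv
      exact absurd (top_le_iff.1 hconv) (EReal.coe_ne_top _)
    · rw [he] at hconv
      have hconv' : e ≤ (1 - t) * a + t * b := by exact_mod_cast hconv
      have h := hz _ e he
      rw [add_sub_cancel_left, inner_smul_right, norm_add_sq_real, inner_smul_right, norm_smul,
        mul_pow, Real.norm_eq_abs, sq_abs] at h
      rw [hw', norm_add_sq_real]
      have : t * (a + inner ℝ z d - α * inner ℝ w d - b) ≤ t * (t * (α / 2 * ‖d‖ ^ 2)) := by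
        nlinarith
      have := le_of_mul_le_mul_left this ht0
      linarith
  by_contra! hcon
  set q := α / 2 * ‖d‖ ^ 2
  set g := a + α / 2 * ‖w‖ ^ 2 + inner ℝ z d + q - (b + α / 2 * ‖w'‖ ^ 2) with hg
  have hg0 : 0 < g := by linarith
  have htend : Tendsto (fun t : ℝ => t * q) (𝓝[>] 0) (𝓝 0) := by
    have : ContinuousAt (fun t : ℝ => t * q) 0 := by fun_prop
    simpa using this.tendsto.mono_left nhdsWithin_le_nhds
  have hle := ge_of_tendsto htend (b := g)
    (by filter_upwards [Ioo_mem_nhdsGT (zero_lt_one' ℝ)] with t ht using key t ht.1 ht.2)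
  linarith

/-- Strong monotonicity of the subdifferential of `R_α`. -/
lemma strong_monotone_subdiff (hR : IsGammaZero R) {w z w' z' : E}
    (hz : z ∈ subdiff (regularized R α) w) (hz' : z' ∈ subdiff (regularized R α) w') :
    α * ‖w' - w‖ ^ 2 ≤ inner ℝ (z' - z) (w' - w) := by
  obtain ⟨a, ha⟩ := hR.exists_eq_coe_of_mem_subdiff hz
  obtain ⟨b, hb⟩ := hR.exists_eq_coe_of_mem_subdiff hz'
  have h1 := strong_subgradient_inequality hR ha hz hb
  have h2 := strong_subgradient_inequality hR hb hz' ha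
  have h3 : inner ℝ z' (w - w') = - inner ℝ z' (w' - w) := by
    rw [← inner_neg_right, neg_sub]
  rw [inner_sub_left]
  rw [h3, norm_sub_rev w w'] at h2
  linarith

/-- Strong monotonicity with Cauchy–Schwarz: the inverse of `∂R_α` is `1/α`-Lipschitz. -/
lemma norm_sub_le_of_mem_subdiff (hR : IsGammaZero R) (hα : 0 < α) {w z w' z' : E}
    (hz : z ∈ subdiff (regularized R α) w) (hz' : z' ∈ subdiff (regularized R α) w') :
    ‖w' - w‖ ≤ ‖z' - z‖ / α := by
  have h := (strong_monotone_subdiff hR hz hz').trans (real_inner_le_norm _ _)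
  rw [le_div_iff₀ hα]
  rcases (norm_nonneg (w' - w)).eq_or_lt with h0 | h0
  · rw [← h0, zero_mul]; exact norm_nonneg _
  · nlinarith

/-- The sum `w + z` with `z ∈ ∂R_α(w)` determines `w`. -/
lemma eq_of_add_eq_add (hR : IsGammaZero R) (hα : 0 < α) {w z w' z' : E}
    (hz : z ∈ subdiff (regularized R α) w) (hz' : z' ∈ subdiff (regularized R α) w')
    (h : w + z = w' + z') : w' = w := by
  have hm := strong_monotone_subdiff hR hz hz'
  have hzz : z' - z = -(w' - w) := by
    rw [neg_sub, sub_eq_sub_iff_add_eq_add, add_comm z', add_comm w, ← h, add_comm]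
  rw [hzz, inner_neg_left, real_inner_self_eq_norm_sq] at hm
  have : ‖w' - w‖ ^ 2 = 0 := by nlinarith [sq_nonneg ‖w' - w‖]
  exact sub_eq_zero.1 (norm_eq_zero.1 (pow_eq_zero_iff two_ne_zero |>.1 this))

/-- Fenchel equality. -/
lemma conj_eq_of_mem_subdiff (hR : IsGammaZero R) {w z : E} {a : ℝ} (ha : R w = a)
    (hz : z ∈ subdiff (regularized R α) w) :
    conj (regularized R α) z = ((inner ℝ z w - (a + α / 2 * ‖w‖ ^ 2) : ℝ) : EReal) := by
  apply le_antisymm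
  · refine iSup_le fun w' => ?_
    rcases hR.eq_top_or_eq_coe w' with hw' | ⟨b, hb⟩
    · rw [regularized_eq_top hw', EReal.sub_top]; exact bot_le
    · rw [regularized_eq_coe hb]
      have := (mem_subdiff_regularized_iff hR ha).1 hz w' b hb
      rw [inner_sub_right] at this
      norm_cast
      linarith
  · refine le_iSup_of_le w ?_
    rw [regularized_eq_coe ha]
    norm_cast

/-- The subdifferential of `R_α` is onto: `⟨z, ·⟩ - R_α` attains its maximum. -/
lemma exists_mem_subdiff_regularized [ProperSpace E] (hR : IsGammaZero R) (hα : 0 < α)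
    {w₁ u : E} (hu : u ∈ subdiff (regularized R α) w₁) (z : E) :
    ∃ w, z ∈ subdiff (regularized R α) w := by
  obtain ⟨a, ha⟩ := hR.exists_eq_coe_of_mem_subdiff hu
  set f : E → EReal := fun w => R w + ((α / 2 * ‖w‖ ^ 2 - inner ℝ z w : ℝ) : EReal) with hf
  have hfcoe : ∀ {w : E} {b : ℝ}, R w = b →
      f w = ((b + (α / 2 * ‖w‖ ^ 2 - inner ℝ z w) : ℝ) : EReal) := by
    intro w b hb; simp [hf, hb]
  have hlsc : LowerSemicontinuous f := by
    refine hR.lsc.add' (Continuous.lowerSemicontinuous ?_) fun w => ?_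
    · exact continuous_coe_real_ereal.comp (by fun_prop)
    · exact EReal.continuousAt_add (Or.inr (EReal.coe_ne_bot _)) (Or.inr (EReal.coe_ne_top _))
  -- Beyond this radius the quadratic growth of `R_α` from `w₁` outweighs the linear term `⟨u - z,
  -- ·⟩`, so minimizing over a compact ball suffices.
  set r := 2 * ‖u - z‖ / α with hr
  have hr0 : 0 ≤ r := by positivity
  obtain ⟨w, -, hw⟩ := LowerSemicontinuousOn.exists_isMinOn
    ⟨w₁, Metric.mem_closedBall_self hr0⟩ (isCompact_closedBall w₁ r)
    (hlsc.lowerSemicontinuousOn _)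
  have hmin : ∀ w', f w ≤ f w' := by
    intro w'
    by_cases hw' : w' ∈ Metric.closedBall w₁ r
    · exact hw hw'
    · refine (hw (Metric.mem_closedBall_self hr0)).trans ?_
      rcases hR.eq_top_or_eq_coe w' with htop | ⟨b, hb⟩
      · simp only [hf, htop, EReal.top_add_coe, le_top]
      · rw [hfcoe ha, hfcoe hb, EReal.coe_le_coe_iff]
        have h1 := strong_subgradient_inequality hR ha hu hb
        rw [Metric.mem_closedBall, not_le, dist_eq_norm, hr, div_lt_iff₀ hα] at hw'
        have h2 := neg_le_of_abs_le (abs_real_inner_le_norm (u - z) (w' - w₁))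
        rw [inner_sub_left, inner_sub_right z] at h2
        have h3 : 0 ≤ ‖w' - w₁‖ * (‖w' - w₁‖ * α - 2 * ‖u - z‖) :=
          mul_nonneg (norm_nonneg _) (by linarith)
        nlinarith
  obtain ⟨e, he⟩ : ∃ e : ℝ, R w = e := by
    rcases hR.eq_top_or_eq_coe w with htop | h
    · have := hmin w₁
      rw [hfcoe ha, hf] at this
      simp only [htop, EReal.top_add_coe] at this
      exact absurd (top_le_iff.1 this) (EReal.coe_ne_top _)
    · exact h
  refine ⟨w, (mem_subdiff_regularized_iff hR he).2 fun w' b hb => ?_⟩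
  have := hmin w'
  rw [hfcoe he, hfcoe hb, EReal.coe_le_coe_iff] at this
  rw [inner_sub_right]
  linarith

/-- `∇R_α^*` inverts the subdifferential of `R_α`. -/
lemma hasGradientAt_conj [ProperSpace E] (hR : IsGammaZero R) (hα : 0 < α) {w z : E}
    (hz : z ∈ subdiff (regularized R α) w) :
    HasGradientAt (fun u => (conj (regularized R α) u).toReal) w z := by
  obtain ⟨a, ha⟩ := hR.exists_eq_coe_of_mem_subdiff hz
  rw [hasGradientAt_iff_isLittleO]
  -- The two subgradient inequalities place this remainder between `0` and `⟨z' - z, w' - w⟩`, which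
  -- the Lipschitz bound makes quadratic.
  have hbig : (fun z' => (conj (regularized R α) z').toReal - (conj (regularized R α) z).toReal
      - inner ℝ w (z' - z)) =O[𝓝 z] fun z' => ‖z' - z‖ ^ 2 := by
    refine Asymptotics.IsBigO.of_bound (1 / α) (Eventually.of_forall fun z' => ?_)
    obtain ⟨w', hw'⟩ := exists_mem_subdiff_regularized hR hα hz z'
    obtain ⟨b, hb⟩ := hR.exists_eq_coe_of_mem_subdiff hw'
    rw [conj_eq_of_mem_subdiff hR ha hz, conj_eq_of_mem_subdiff hR hb hw', EReal.toReal_coe,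
      EReal.toReal_coe]
    have h1 := (mem_subdiff_regularized_iff hR ha).1 hz w' b hb
    have h2 := (mem_subdiff_regularized_iff hR hb).1 hw' w a ha
    have h3 := norm_sub_le_of_mem_subdiff hR hα hz hw'
    have h4 := real_inner_le_norm (z' - z) (w' - w)
    have h5 : ‖z' - z‖ * ‖w' - w‖ ≤ 1 / α * ‖z' - z‖ ^ 2 := by
      calc ‖z' - z‖ * ‖w' - w‖ ≤ ‖z' - z‖ * (‖z' - z‖ / α) := by gcongr
        _ = _ := by ring
    rw [Real.norm_eq_abs, Real.norm_eq_abs, abs_of_nonneg (sq_nonneg ‖z' - z‖)]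
    rw [real_inner_comm (z' - z) w]
    simp only [inner_sub_left, inner_sub_right] at *
    rw [abs_le]
    constructor <;> linarith [mul_nonneg (one_div_pos.2 hα).le (sq_nonneg ‖z' - z‖)]
  refine hbig.trans_isLittleO ?_
  have : (fun z' : E => ‖z' - z‖ ^ 2) =o[𝓝 z] fun z' => ‖z' - z‖ ^ 1 :=
    Asymptotics.IsLittleO.comp_tendsto
      (Asymptotics.isLittleO_norm_pow_norm_pow (E' := E) one_lt_two)
      (tendsto_sub_nhds_zero_iff.2 tendsto_id)
  simp only [pow_one] at this
  exact this.of_norm_right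

lemma gradConj_eq [ProperSpace E] (hR : IsGammaZero R) (hα : 0 < α) {w z : E}
    (hz : z ∈ subdiff (regularized R α) w) : gradConj R α z = w :=
  (hasGradientAt_conj hR hα hz).gradient

lemma mem_subdiff_gradConj [ProperSpace E] (hR : IsGammaZero R) (hα : 0 < α)
    {w₁ u : E} (hu : u ∈ subdiff (regularized R α) w₁) (z : E) :
    z ∈ subdiff (regularized R α) (gradConj R α z) := by
  obtain ⟨w, hw⟩ := exists_mem_subdiff_regularized hR hα hu z
  rwa [gradConj_eq hR hα hw]

variable {F : Type*} [NormedAddCommGroup F] [InnerProductSpace ℝ F] [CompleteSpace F]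

lemma gradient_dualObjective [ProperSpace E] (hR : IsGammaZero R) (hα : 0 < α)
    {w₁ u : E} (hu : u ∈ subdiff (regularized R α) w₁) (X : E →L[ℝ] F) (y v : F) :
    gradient (fun u => (dualObjective R α X y u).toReal) v =
      y - X (gradConj R α (dualToPrimal X v)) := by
  have hsub := mem_subdiff_gradConj hR hα hu
  have hfun : (fun u => (dualObjective R α X y u).toReal) = fun v =>
      (conj (regularized R α) (dualToPrimal X v)).toReal + inner ℝ y v := by
    funext v
    obtain ⟨a, ha⟩ := hR.exists_eq_coe_of_mem_subdiff (hsub (dualToPrimal X v))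
    rw [dualObjective, conj_eq_of_mem_subdiff hR ha (hsub _), ← EReal.coe_add, EReal.toReal_coe,
      EReal.toReal_coe]
  rw [hfun]
  apply HasGradientAt.gradient
  rw [hasGradientAt_iff_hasFDerivAt]
  have h1 := (hasGradientAt_conj hR hα (hsub (dualToPrimal X v))).hasFDerivAt
  have h2 : HasFDerivAt (dualToPrimal X) (-(ContinuousLinearMap.adjoint X)) v :=
    (-(ContinuousLinearMap.adjoint X)).hasFDerivAt
  have h3 : HasFDerivAt (fun v : F => (inner ℝ y v : ℝ)) (innerSL ℝ y) v :=
    (innerSL ℝ y).hasFDerivAt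
  refine ((h1.comp v h2).add h3).congr_fderiv ?_
  ext x
  simp [ContinuousLinearMap.adjoint_inner_right]
  ring

end RegularizedConjugate

end DualFlow

namespace DualFlow

/-! ### Differential inequalities and estimates for the dual flow. -/

section Flow

lemma sub_le_mul_sub_of_hasDerivWithinAt_le {f f' : ℝ → ℝ} {a b C : ℝ}
    (hf : ∀ t, 0 ≤ t → HasDerivWithinAt f (f' t) (Set.Ici 0) t) (ha : 0 ≤ a) (hab : a ≤ b)
    (hC : ∀ t ∈ Set.Ioo a b, f' t ≤ C) : f b - f a ≤ C * (b - a) := by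
  have hderiv : ∀ t ∈ Set.Ioo a b, HasDerivAt f (f' t) t := fun t ht =>
    (hf t (ha.trans ht.1.le)).hasDerivAt (Ici_mem_nhds (ha.trans_lt ht.1))
  refine (convex_Icc a b).image_sub_le_mul_sub_of_deriv_le (fun t ht => ?_) ?_ ?_
    a (Set.left_mem_Icc.2 hab) b (Set.right_mem_Icc.2 hab) hab
  · exact (hf t (ha.trans ht.1)).continuousWithinAt.mono fun s hs => ha.trans hs.1
  · rw [interior_Icc]
    exact fun t ht => (hderiv t ht).differentiableAt.differentiableWithinAt
  · rw [interior_Icc]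
    intro t ht
    rw [(hderiv t ht).deriv]
    exact hC t ht

variable {F : Type*} [NormedAddCommGroup F] [InnerProductSpace ℝ F]

/-- If `⟨d, d'⟩ ≤ δ ‖d‖`, then `‖d‖` grows at rate at most `δ`. -/
lemma norm_le_of_inner_deriv_le {d d' : ℝ → F} {δ : ℝ} (hδ : 0 ≤ δ)
    (hd : ∀ t, 0 ≤ t → HasDerivWithinAt d (d' t) (Set.Ici 0) t)
    (hi : ∀ t, 0 ≤ t → inner ℝ (d t) (d' t) ≤ δ * ‖d t‖) {s t : ℝ} (hs : 0 ≤ s) (hst : s ≤ t) :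
    ‖d t‖ ≤ ‖d s‖ + δ * (t - s) := by
  -- The norm need not be differentiable where `d` vanishes; `√(‖d‖² + e²)` is, at a cost of `e`.
  refine le_of_forall_pos_le_add fun e he => ?_
  have hpos : ∀ r, 0 < ‖d r‖ ^ 2 + e ^ 2 := fun r => by positivity
  have hnorm : ∀ r, ‖d r‖ ≤ √(‖d r‖ ^ 2 + e ^ 2) := fun r =>
    Real.le_sqrt_of_sq_le (by nlinarith [sq_nonneg e])
  have hderiv : ∀ r, 0 ≤ r → HasDerivWithinAt (fun r => √(‖d r‖ ^ 2 + e ^ 2))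
      (2 * inner ℝ (d r) (d' r) / (2 * √(‖d r‖ ^ 2 + e ^ 2))) (Set.Ici 0) r := fun r hr =>
    (((hd r hr).norm_sq).add_const (e ^ 2)).sqrt (hpos r).ne'
  have h := sub_le_mul_sub_of_hasDerivWithinAt_le (C := δ) hderiv hs hst fun r hr => by
    have hr0 := hs.trans hr.1.le
    rw [mul_div_mul_left _ _ two_ne_zero, div_le_iff₀ (Real.sqrt_pos.2 (hpos r))]
    exact (hi r hr0).trans (mul_le_mul_of_nonneg_left (hnorm r) hδ)
  have hs' : √(‖d s‖ ^ 2 + e ^ 2) ≤ ‖d s‖ + e := by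
    rw [Real.sqrt_le_left (by positivity)]
    nlinarith [mul_nonneg (norm_nonneg (d s)) he.le]
  linarith [hnorm t]

/-- A ball that is centred at a point of a set and misses its frontier lies in the set. -/
lemma ball_subset_of_lt_infEDist_frontier {S : Set F} {x : F} {r : ℝ} (hx : x ∈ S) (hr : 0 < r)
    (h : ENNReal.ofReal r < Metric.infEDist x (frontier S)) : Metric.ball x r ⊆ S := by
  have hdisj : ∀ z ∈ Metric.ball x r, z ∉ frontier S := by
    intro z hz hzS
    have h1 := Metric.infEDist_le_edist_of_mem (x := x) hzS
    rw [edist_dist, dist_comm] at h1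
    exact (h.trans_le (h1.trans (ENNReal.ofReal_le_ofReal (Metric.mem_ball.1 hz).le))).false
  -- The ball is connected, so it lies in one of these disjoint open sets; its centre decides which.
  have hcover : Metric.ball x r ⊆ interior S ∪ (closure S)ᶜ := by
    intro z hz
    by_cases hzc : z ∈ closure S
    · exact Or.inl (by_contra fun hzi => hdisj z hz ⟨hzc, hzi⟩)
    · exact Or.inr hzc
  rcases (convex_ball x r).isPreconnected.subset_or_subset isOpen_interior
    isClosed_closure.isOpen_compl (Set.disjoint_left.2 fun z hz hz' =>
      hz' (subset_closure (interior_subset hz))) hcover with hsub | hsub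
  · exact hsub.trans interior_subset
  · exact absurd (subset_closure hx) (hsub (Metric.mem_ball_self hr))

variable {E : Type*} [NormedAddCommGroup E] [InnerProductSpace ℝ E] [ProperSpace E]
  [CompleteSpace F] {R : E → EReal} {α : ℝ} {X : E →L[ℝ] F} {w₀ : E} {v₀ : F}

lemma dualToPrimal_sub (X : E →L[ℝ] F) (v v' : F) :
    dualToPrimal X v' - dualToPrimal X v = dualToPrimal X (v' - v) := by
  simp only [dualToPrimal, map_sub]; abel

lemma norm_dualToPrimal_le (X : E →L[ℝ] F) (v : F) : ‖dualToPrimal X v‖ ≤ ‖X‖ * ‖v‖ := by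
  rw [dualToPrimal, norm_neg, ← LinearIsometryEquiv.norm_map ContinuousLinearMap.adjoint X]
  exact ContinuousLinearMap.le_opNorm _ _

/-- Strong monotonicity moved through the adjoint: the dissipation behind every flow estimate below.
-/
lemma inner_sub_apply_sub_le (hR : IsGammaZero R) {v v' : F} {w w' : E}
    (hw : dualToPrimal X v ∈ subdiff (regularized R α) w)
    (hw' : dualToPrimal X v' ∈ subdiff (regularized R α) w') :
    inner ℝ (v' - v) (X w' - X w) ≤ -(α * ‖w' - w‖ ^ 2) := by
  have h := strong_monotone_subdiff hR hw hw'
  rw [dualToPrimal_sub, dualToPrimal, inner_neg_left, ContinuousLinearMap.adjoint_inner_left,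
    map_sub] at h
  linarith

lemma continuous_gradConj (hR : IsGammaZero R) (hα : 0 < α) {w₁ u : E}
    (hu : u ∈ subdiff (regularized R α) w₁) : Continuous (gradConj R α) := by
  have hsub := mem_subdiff_gradConj hR hα hu
  refine LipschitzWith.continuous (K := (1 / α).toNNReal)
    (LipschitzWith.of_dist_le_mul fun z z' => ?_)
  rw [dist_eq_norm, dist_eq_norm, Real.coe_toNNReal _ (one_div_pos.2 hα).le, one_div_mul_eq_div]
  exact norm_sub_le_of_mem_subdiff hR hα (hsub z') (hsub z)

lemma continuous_dualToPrimal (X : E →L[ℝ] F) : Continuous (dualToPrimal X) :=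
  (ContinuousLinearMap.adjoint X).continuous.neg

namespace IsDualGradientFlow

variable {y y' : F} {v v' : ℝ → F}

lemma hasDerivWithinAt (hv : IsDualGradientFlow R α X y v) (hR : IsGammaZero R) (hα : 0 < α)
    {w₁ u : E} (hu : u ∈ subdiff (regularized R α) w₁) {t : ℝ} (ht : 0 ≤ t) :
    HasDerivWithinAt v (X (primalTrajectory R α X v t) - y) (Set.Ici 0) t := by
  have h := hv.2 t ht
  rwa [gradient_dualObjective hR hα hu, neg_sub] at h

lemma hasDerivWithinAt_shift (hv : IsDualGradientFlow R α X y v) (hR : IsGammaZero R)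
    (hα : 0 < α) {w₁ u : E} (hu : u ∈ subdiff (regularized R α) w₁) {h : ℝ} (hh : 0 ≤ h)
    {t : ℝ} (ht : 0 ≤ t) :
    HasDerivWithinAt (fun s => v (s + h)) (X (primalTrajectory R α X v (t + h)) - y)
      (Set.Ici 0) t := by
  have h1 := hv.hasDerivWithinAt hR hα hu (add_nonneg ht hh)
  have h2 : HasDerivWithinAt (fun s : ℝ => s + h) 1 (Set.Ici 0) t :=
    (hasDerivWithinAt_id t _).add_const h
  simpa [Function.comp_def] using
    h1.scomp t h2 (fun s hs => add_nonneg (Set.mem_Ici.1 hs) hh)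

/-- Two dual flows separate at most at the rate given by the difference of their data. -/
lemma norm_sub_le (hv : IsDualGradientFlow R α X y v) (hv' : IsDualGradientFlow R α X y' v')
    (hR : IsGammaZero R) (hα : 0 < α) {w₁ u : E} (hu : u ∈ subdiff (regularized R α) w₁)
    {t : ℝ} (ht : 0 ≤ t) : ‖v' t - v t‖ ≤ ‖y' - y‖ * t := by
  have hsub := mem_subdiff_gradConj hR hα hu
  have h := norm_le_of_inner_deriv_le (d := fun t => v' t - v t) (norm_nonneg (y' - y))
    (fun t ht => (hv'.hasDerivWithinAt hR hα hu ht).sub (hv.hasDerivWithinAt hR hα hu ht))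
    (fun t ht => ?_) le_rfl ht
  · simpa [hv.1, hv'.1] using h
  · have h1 := inner_sub_apply_sub_le hR (hsub (dualToPrimal X (v t)))
      (hsub (dualToPrimal X (v' t)))
    have h2 := neg_le_of_abs_le (abs_real_inner_le_norm (v' t - v t) (y' - y))
    rw [sub_sub_sub_comm, inner_sub_right]
    have h3 := mul_nonneg hα.le
      (sq_nonneg ‖gradConj R α (dualToPrimal X (v' t)) - gradConj R α (dualToPrimal X (v t))‖)
    simp only [primalTrajectory]
    linarith

/-- The distance of the flow to a stationary point of another flow. -/
lemma norm_sub_stationary_le (hv : IsDualGradientFlow R α X y v) (hR : IsGammaZero R)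
    (hα : 0 < α) (hw₀ : dualToPrimal X v₀ ∈ subdiff (regularized R α) w₀)
    {t : ℝ} (ht : 0 ≤ t) : ‖v t - v₀‖ ≤ ‖v₀‖ + ‖y - X w₀‖ * t := by
  have hsub := mem_subdiff_gradConj hR hα hw₀
  have h := norm_le_of_inner_deriv_le (d := fun t => v t - v₀) (norm_nonneg (y - X w₀))
    (fun t ht => (hv.hasDerivWithinAt hR hα hw₀ ht).sub_const v₀) (fun t ht => ?_) le_rfl ht
  · simpa [hv.1] using h
  · have h1 := inner_sub_apply_sub_le hR hw₀ (hsub (dualToPrimal X (v t)))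
    have h2 := neg_le_of_abs_le (abs_real_inner_le_norm (v t - v₀) (y - X w₀))
    have h3 := mul_nonneg hα.le (sq_nonneg ‖gradConj R α (dualToPrimal X (v t)) - w₀‖)
    simp only [primalTrajectory]
    rw [← sub_sub_sub_cancel_right (X _) y (X w₀), inner_sub_right]
    linarith

/-- The speed of the dual flow is nonincreasing. -/
lemma norm_velocity_antitone (hv : IsDualGradientFlow R α X y v) (hR : IsGammaZero R)
    (hα : 0 < α) {w₁ u : E} (hu : u ∈ subdiff (regularized R α) w₁) {s t : ℝ} (hs : 0 ≤ s)
    (hst : s ≤ t) :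
    ‖X (primalTrajectory R α X v t) - y‖ ≤ ‖X (primalTrajectory R α X v s) - y‖ := by
  have hsub := mem_subdiff_gradConj hR hα hu
  -- The time shift solves the same equation with the same data, so its distance to `v` cannot grow;
  -- dividing by `h → 0` yields the speeds.
  have hincr : ∀ h : ℝ, 0 < h → ‖v (t + h) - v t‖ ≤ ‖v (s + h) - v s‖ := by
    intro h hh
    have key := norm_le_of_inner_deriv_le (d := fun t => v (t + h) - v t) le_rfl
      (fun t ht => (hv.hasDerivWithinAt_shift hR hα hu hh.le ht).sub
        (hv.hasDerivWithinAt hR hα hu ht)) (fun t ht => ?_) hs hst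
    · simpa using key
    · have h1 := inner_sub_apply_sub_le hR (hsub (dualToPrimal X (v t)))
        (hsub (dualToPrimal X (v (t + h))))
      have h3 := mul_nonneg hα.le (sq_nonneg
        ‖gradConj R α (dualToPrimal X (v (t + h))) - gradConj R α (dualToPrimal X (v t))‖)
      simp only [primalTrajectory, sub_sub_sub_cancel_right]
      linarith
  have hslope : ∀ r, 0 ≤ r → Tendsto (fun h : ℝ => ‖h⁻¹ • (v (r + h) - v r)‖) (𝓝[>] 0)
      (𝓝 ‖X (primalTrajectory R α X v r) - y‖) := by
    intro r hr
    have h1 := (hv.hasDerivWithinAt hR hα hu (t := 0 + r) (by simpa using hr))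
    have h2 : HasDerivWithinAt (fun h : ℝ => r + h) 1 (Set.Ioi 0) 0 :=
      (hasDerivWithinAt_id (0 : ℝ) _).const_add r
    rw [zero_add] at h1
    rw [← add_zero r] at h1
    have h3 := h1.scomp (0 : ℝ) h2 (fun x hx => add_nonneg hr (le_of_lt hx))
    rw [hasDerivWithinAt_iff_tendsto_slope' (by simp)] at h3
    simpa [slope_def_module, Function.comp_def] using h3.norm
  refine le_of_tendsto_of_tendsto (hslope t (hs.trans hst)) (hslope s hs) ?_
  filter_upwards [self_mem_nhdsWithin] with h hh
  rw [norm_smul, norm_smul]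
  exact mul_le_mul_of_nonneg_left (hincr h hh) (norm_nonneg _)

end IsDualGradientFlow

/-! ### Primal convergence and identification of the manifold. -/

/-- For stopping times proportional to `δ⁻¹`, the primal trajectory of the noisy flow
approaches the noise-free solution as the noise level `δ` goes to `0`. -/
lemma exists_norm_primalTrajectory_sub_le (hR : IsGammaZero R) (hα : 0 < α) (hX : X ≠ 0)
    (hw₀ : dualToPrimal X v₀ ∈ subdiff (regularized R α) w₀) {c K η : ℝ} (hc : 0 < c)
    (hK : 0 ≤ K) (hη : 0 < η) :
    ∃ δ₁ : ℝ, 0 < δ₁ ∧ ∀ δ : ℝ, 0 < δ → δ < δ₁ → ∀ y : F, ‖y - X w₀‖ ≤ δ →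
      ∀ v : ℝ → F, IsDualGradientFlow R α X y v → ∀ t : ℝ, c ≤ δ * t → δ * t ≤ K →
        ‖primalTrajectory R α X v t - w₀‖ ≤ η := by
  have hN : 0 < ‖X‖ := norm_pos_iff.2 hX
  set B := ‖v₀‖ + K + 1 with hB
  have hB0 : 0 < B := by positivity
  set m := α * η ^ 2 / B with hm
  have hm0 : 0 < m := by positivity
  set μ := m / (2 * ‖X‖) with hμ
  have hμ0 : 0 < μ := by positivity
  -- The first bound lets the residual absorb the noise twice, the second makes dissipation dominate
  -- noise, and the third contradicts `α μ² t ≤ ‖v₀‖²` when `t ≥ c / δ`.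
  refine ⟨min (m / 4) (min (α * μ ^ 2 / (2 * B)) (c * α * μ ^ 2 / (2 * (‖v₀‖ ^ 2 + 1)))),
    by positivity, ?_⟩
  intro δ hδ0 hδ y hy v hv t hct htK
  rw [lt_min_iff, lt_min_iff] at hδ
  obtain ⟨hδm, hδB, hδc⟩ := hδ
  rw [lt_div_iff₀ (by positivity)] at hδB hδc
  have hsub := mem_subdiff_gradConj hR hα hw₀
  have ht0 : 0 < t := pos_of_mul_pos_right (hc.trans_le hct) hδ0.le
  have hvB : ∀ s, 0 ≤ s → s ≤ t → ‖v s - v₀‖ ≤ B := by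
    intro s hs hst
    have h1 := hv.norm_sub_stationary_le hR hα hw₀ hs
    have h2 : ‖y - X w₀‖ * s ≤ δ * t := by gcongr
    linarith
  by_contra! hcon
  have hresid : m ≤ ‖X (primalTrajectory R α X v t) - X w₀‖ := by
    rw [hm, div_le_iff₀ hB0]
    have h1 := inner_sub_apply_sub_le hR hw₀ (hsub (dualToPrimal X (v t)))
    have h2 := neg_le_of_abs_le (abs_real_inner_le_norm (v t - v₀)
      (X (primalTrajectory R α X v t) - X w₀))
    have h3 : α * η ^ 2 ≤ α * ‖primalTrajectory R α X v t - w₀‖ ^ 2 := by gcongr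
    have h4 : ‖v t - v₀‖ * ‖X (primalTrajectory R α X v t) - X w₀‖ ≤
        B * ‖X (primalTrajectory R α X v t) - X w₀‖ := by
      gcongr; exact hvB t ht0.le le_rfl
    simp only [primalTrajectory] at *
    linarith
  have hfar : ∀ s, 0 ≤ s → s ≤ t → μ ≤ ‖primalTrajectory R α X v s - w₀‖ := by
    intro s hs hst
    have h1 := hv.norm_velocity_antitone hR hα hw₀ hs hst
    have h2 := norm_sub_le_norm_sub_add_norm_sub (X (primalTrajectory R α X v t)) y (X w₀)
    have h3 := norm_sub_le_norm_sub_add_norm_sub (X (primalTrajectory R α X v s)) (X w₀) y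
    rw [norm_sub_rev (X w₀) y] at h3
    have h4 := X.le_opNorm (primalTrajectory R α X v s - w₀)
    rw [map_sub] at h4
    rw [hμ, div_le_iff₀ (by positivity)]
    linarith
  -- The derivative is at most `-2 α μ² + 2 B δ`, and `2 B δ < α μ²`.
  have hdecr := sub_le_mul_sub_of_hasDerivWithinAt_le (f := fun s => ‖v s - v₀‖ ^ 2)
    (C := -(α * μ ^ 2)) (fun s hs => ((hv.hasDerivWithinAt hR hα hw₀ hs).sub_const v₀).norm_sq)
    le_rfl ht0.le fun s hs => by
      have h1 := inner_sub_apply_sub_le hR hw₀ (hsub (dualToPrimal X (v s)))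
      have h2 := neg_le_of_abs_le (abs_real_inner_le_norm (v s - v₀) (y - X w₀))
      have h3 : α * μ ^ 2 ≤ α * ‖primalTrajectory R α X v s - w₀‖ ^ 2 := by
        gcongr; exact hfar s hs.1.le hs.2.le
      have h4 : ‖v s - v₀‖ * ‖y - X w₀‖ ≤ B * δ := by
        gcongr; exact hvB s hs.1.le hs.2.le
      rw [← sub_sub_sub_cancel_right (X _) y (X w₀), inner_sub_right]
      simp only [primalTrajectory] at *
      linarith
  rw [hv.1, zero_sub, norm_neg, sub_zero] at hdecr
  have h5 : α * μ ^ 2 * t ≤ ‖v₀‖ ^ 2 := by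
    nlinarith [sq_nonneg ‖v t - v₀‖]
  have h6 : α * μ ^ 2 * c ≤ α * μ ^ 2 * (δ * t) := by gcongr
  have h7 : δ * (α * μ ^ 2 * t) ≤ δ * ‖v₀‖ ^ 2 := by gcongr
  nlinarith [sq_nonneg ‖v₀‖, mul_nonneg hδ0.le (sq_nonneg ‖v₀‖)]

/-- A point `z + ∇R_α^*(z)` in the local union has its primal part on the manifold. -/
lemma gradConj_mem_of_add_mem_localUnion (hR : IsGammaZero R) (hα : 0 < α) {w₁ u : E}
    (hu : u ∈ subdiff (regularized R α) w₁) {M : Set E} {ε : ℝ} {z : E}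
    (hz : gradConj R α z + z ∈ localUnion (regularized R α) M w₀ ε) : gradConj R α z ∈ M := by
  simp only [localUnion, Set.mem_iUnion, Set.mem_vadd_set, vadd_eq_add] at hz
  obtain ⟨w, hw, q, hq, heq⟩ := hz
  rw [eq_of_add_eq_add hR hα hq (mem_subdiff_gradConj hR hα hu z) heq]
  exact hw.1

end Flow

end DualFlow

/-! ### Choice of the noise threshold and conclusion. -/

theorem corollary4p5 {n p : ℕ}
    (R : EuclideanSpace ℝ (Fin p) → EReal) (α : ℝ) (hα : 0 < α)
    (X : EuclideanSpace ℝ (Fin p) →L[ℝ] EuclideanSpace ℝ (Fin n)) (hX : X ≠ 0)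
    (M : Set (EuclideanSpace ℝ (Fin p)))
    (w₀ : EuclideanSpace ℝ (Fin p)) (y₀ v₀ : EuclideanSpace ℝ (Fin n))
    -- the ground truth is the unique solution of the noise-free problem
    (hw₀ : DualFlow.IsUniqueMinimizerOn (DualFlow.regularized R α) {w | X w = y₀} w₀)
    -- the noise-free dual flow converges to the dual solution `v₀`
    (hv₀ : IsMinOn (DualFlow.dualObjective R α X y₀) Set.univ v₀)
    (vfree : ℝ → EuclideanSpace ℝ (Fin n))
    (hvfree : DualFlow.IsDualGradientFlow R α X y₀ vfree)
    (hlim : Tendsto vfree atTop (𝓝 v₀))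
    -- nondegenerate source condition
    (hSC : DualFlow.dualToPrimal X v₀ ∈
      intrinsicInterior ℝ (DualFlow.subdiff (DualFlow.regularized R α) w₀))
    -- partial smoothness
    (hR : DualFlow.PartlySmoothAt R M w₀)
    -- the constants: `κ` is a bound for `α c_δ / ‖X‖` below the distance to the boundary
    (ε : ℝ) (hε : 0 < ε) (c : ℝ) (hc : 0 < c) (κ : ℝ)
    (hκ : ENNReal.ofReal κ < Metric.infEDist (w₀ + DualFlow.dualToPrimal X v₀)
      (frontier (DualFlow.localUnion (DualFlow.regularized R α) M w₀ ε))) :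
    ∃ δ₀ : ℝ, 0 < δ₀ ∧ ∀ δ : ℝ, 0 < δ → δ < δ₀ →
      ∀ y : EuclideanSpace ℝ (Fin n), ‖y - y₀‖ ≤ δ →
      ∀ v : ℝ → EuclideanSpace ℝ (Fin n), DualFlow.IsDualGradientFlow R α X y v →
      -- stopping time `t_δ = γ c_δ / δ` with `γ = α / ‖X‖ ^ 2`
      ∀ cδ tδ : ℝ, c ≤ cδ → α * cδ * ‖X‖⁻¹ ≤ κ → tδ = α / ‖X‖ ^ 2 * (cδ / δ) →
        DualFlow.primalTrajectory R α X v tδ ∈ M ∧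
        ∃ tlow tup : ℝ, 0 < tlow ∧ tlow < tδ ∧ tδ < tup ∧
          ∀ t ∈ Set.Icc tlow tup, DualFlow.primalTrajectory R α X v t ∈ M := by
  have hΓ := hR.gammaZero
  have hsub := intrinsicInterior_subset hSC
  have hXw : X w₀ = y₀ := hw₀.1
  have hN : 0 < ‖X‖ := norm_pos_iff.2 hX
  -- For negative `κ` no stopping time is admissible.
  rcases lt_or_ge κ 0 with hκ0 | hκ0
  · refine ⟨1, one_pos, fun δ _ _ y _ v _ cδ tδ hcδ hle _ => absurd hle (not_le.2 ?_)⟩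
    have : 0 < cδ := hc.trans_le hcδ
    exact hκ0.trans (by positivity)
  obtain ⟨r, hr0, hκr, hr⟩ := ENNReal.lt_iff_exists_real_btwn.1 hκ
  rw [ENNReal.ofReal_lt_ofReal_iff_of_nonneg hκ0] at hκr
  have hmem : w₀ + DualFlow.dualToPrimal X v₀ ∈
      DualFlow.localUnion (DualFlow.regularized R α) M w₀ ε :=
    Set.mem_iUnion₂.2 ⟨w₀, ⟨hR.manifold.1, Metric.mem_ball_self hε⟩,
      Set.vadd_mem_vadd_set hsub⟩
  have hball := DualFlow.ball_subset_of_lt_infEDist_frontier hmem (hκ0.trans_lt hκr) hr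
  -- The dual error will be at most `κ + η` and the primal one at most `η`, totalling less than `r =
  -- κ + 3η`.
  set η := (r - κ) / 3 with hη
  have hη0 : 0 < η := by rw [hη]; linarith
  obtain ⟨δ₁, hδ₁, hprimal⟩ := DualFlow.exists_norm_primalTrajectory_sub_le hΓ hα hX hsub
    (c := α / ‖X‖ ^ 2 * c) (K := κ / ‖X‖) (η := η) (by positivity) (by positivity) hη0
  obtain ⟨T, hT⟩ := Metric.tendsto_atTop.1 hlim (η / ‖X‖) (by positivity)
  -- The second term forces `tδ ≥ |T| + 1`, when the noise-free flow is already close to `v₀`.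
  refine ⟨min δ₁ (α / ‖X‖ ^ 2 * c / (|T| + 1)), by positivity, ?_⟩
  intro δ hδ0 hδ y hy v hv cδ tδ hcδ hle htδ
  rw [lt_min_iff, lt_div_iff₀ (by positivity)] at hδ
  have hcδ0 : 0 < cδ := hc.trans_le hcδ
  have htpos : 0 < tδ := by rw [htδ]; positivity
  have hδt : δ * tδ = α / ‖X‖ ^ 2 * cδ := by rw [htδ]; field_simp
  have hlow : α / ‖X‖ ^ 2 * c ≤ δ * tδ := by rw [hδt]; gcongr
  have hXδt : ‖X‖ * (δ * tδ) ≤ κ := by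
    rw [hδt]; convert hle using 1; field_simp
  have hTt : T ≤ tδ := by
    have : |T| + 1 ≤ tδ := le_of_mul_le_mul_left (hδ.2.le.trans hlow) hδ0
    linarith [le_abs_self T]
  have hw : ‖DualFlow.primalTrajectory R α X v tδ - w₀‖ ≤ η :=
    hprimal δ hδ0 hδ.1 y (by rwa [hXw]) v hv tδ hlow
      (by rw [le_div_iff₀ hN, mul_comm]; exact hXδt)
  have hz : ‖DualFlow.dualToPrimal X (v tδ) - DualFlow.dualToPrimal X v₀‖ ≤ κ + η := by
    rw [DualFlow.dualToPrimal_sub]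
    refine (DualFlow.norm_dualToPrimal_le X _).trans ?_
    have h1 := hvfree.norm_sub_le hv hΓ hα hsub htpos.le
    have h2 := (hT tδ hTt).le
    rw [dist_eq_norm, le_div_iff₀ hN] at h2
    have h3 : ‖v tδ - v₀‖ ≤ ‖v tδ - vfree tδ‖ + ‖vfree tδ - v₀‖ :=
      norm_sub_le_norm_sub_add_norm_sub _ _ _
    have h4 : ‖y - y₀‖ * tδ ≤ δ * tδ := by gcongr
    calc ‖X‖ * ‖v tδ - v₀‖ ≤ ‖X‖ * (δ * tδ + ‖vfree tδ - v₀‖) := by gcongr; linarith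
      _ ≤ κ + η := by linarith
  set G : ℝ → EuclideanSpace ℝ (Fin p) := fun t =>
    DualFlow.primalTrajectory R α X v t + DualFlow.dualToPrimal X (v t) with hG
  have hGt : G tδ ∈ Metric.ball (w₀ + DualFlow.dualToPrimal X v₀) r := by
    rw [mem_ball_iff_norm, hG, add_sub_add_comm]
    refine (norm_add_le _ _).trans_lt ?_
    have : r = κ + 3 * η := by rw [hη]; ring
    linarith
  have hvcont : ContinuousAt v tδ :=
    (hv.2 tδ htpos.le).continuousWithinAt.continuousAt (Ici_mem_nhds htpos)
  have hGcont : ContinuousAt G tδ := by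
    have hdual := (DualFlow.continuous_dualToPrimal X).continuousAt.comp hvcont
    exact ((DualFlow.continuous_gradConj hΓ hα hsub).continuousAt.comp hdual).add hdual
  have hev := hGcont.eventually (Metric.isOpen_ball.mem_nhds hGt)
  have hevM : ∀ᶠ t in 𝓝 tδ, DualFlow.primalTrajectory R α X v t ∈ M := by
    filter_upwards [hev] with t ht
    exact DualFlow.gradConj_mem_of_add_mem_localUnion hΓ hα hsub (hball ht)
  obtain ⟨ρ, hρ, hρM⟩ := Metric.eventually_nhds_iff.1 hevM
  refine ⟨hevM.self_of_nhds, max (tδ / 2) (tδ - ρ / 2), tδ + ρ / 2, ?_, ?_, ?_, ?_⟩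
  · exact lt_max_of_lt_left (by linarith)
  · exact max_lt (by linarith) (by linarith)
  · linarith
  · intro t ht
    refine hρM ?_
    have := (le_max_right (tδ / 2) (tδ - ρ / 2)).trans ht.1
    have := ht.2
    rw [Real.dist_eq, abs_lt]
    constructor <;> linarith
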